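/- There is an absolute constant $C>0$ such that the following holds for every integer $N\ge 0$. Consider a dynamic set $S$ of (distinct) axis-parallel closed rectangles $[x_1,x_2]\times[y_1,y_2]\subset\mathbb{R}^2$ with $x_1\le x_2$, $y_1\le y_2$ and all four coordinates in the universe $\{0,\dots,N-1\}$; $S$ is initially empty, and each update either inserts a rectangle that is not in $S$ or deletes a rectangle that is in $S$. A coloring of $S$ by natural numbers is called conflict-free if every point $q\in\mathbb{R}^2$ that lies in some rectangle of $S$ lies in a rectangle of $S$ whose color differs from the colors of all other rectangles of $S$ containing $q$. Then there is a deterministic online strategy (the coloring at any time depends only on the updates made so far) that maintains a conflict-free coloring of $S$ such that, for every sequence of updates, * at any time the number of different colors in use is at most $C\,\log^2(N+1)\,\log^2(n+1)$, and * each single update (insertion or deletion) causes at most $C\log(n+1)$ recolorings, that is, at most that many rectangles present both before and after the update change their color, where $n$ is the current number of rectangles in $S$ (for recolorings: after the update). That is, a conflict-free coloring can be maintained with $O(\log^2 N\log^2 n)$ colors and $O(\log n)$ recolorings per insertion and deletion, in the worst case. -/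

import Mathlib

namespace DynCF

/-- An axis-parallel rectangle `[x₁, x₂] × [y₁, y₂]` whose coordinates come from the universe
`{0, …, N - 1}`. -/
structure GridRect (N : ℕ) where
  x₁ : Fin N
  x₂ : Fin N
  y₁ : Fin N
  y₂ : Fin N
  hx : x₁ ≤ x₂
  hy : y₁ ≤ y₂

/-- The closed region of the real plane occupied by the rectangle. -/
def GridRect.region {N : ℕ} (r : GridRect N) : Set (ℝ × ℝ) :=
  Set.Icc ((r.x₁ : ℕ) : ℝ) ((r.x₂ : ℕ) : ℝ) ×ˢ Set.Icc ((r.y₁ : ℕ) : ℝ) ((r.y₂ : ℕ) : ℝ)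

/-- The coloring `col` of the finite set `S` of planar objects is conflict-free with respect to
points: every point `q` that lies in some object of `S` lies in an object of `S` whose color is
unique among the objects of `S` containing `q`. -/
def IsConflictFree {α : Type*} (region : α → Set (ℝ × ℝ)) (S : Finset α) (col : α → ℕ) : Prop :=
  ∀ q : ℝ × ℝ, (∃ r ∈ S, q ∈ region r) →
    ∃ r ∈ S, q ∈ region r ∧ ∀ r' ∈ S, q ∈ region r' → col r' = col r → r' = r

/-- An update: the insertion or the deletion of one object. -/
inductive Update (α : Type*) where
  | insert (a : α) : Update α
  | delete (a : α) : Update α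

/-- A sequence of updates, starting from the empty set, with the most recent update at the head
of the list. -/
abbrev History (α : Type*) := List (Update α)

open Classical in
/-- The set of objects that are present after the updates of a history. -/
noncomputable def History.current {α : Type*} : History α → Finset α
  | [] => ∅
  | Update.insert a :: h => insert a (History.current h)
  | Update.delete a :: h => (History.current h).erase a

/-- A history is valid if only absent objects are inserted and only present objects are
deleted. -/
def History.Valid {α : Type*} : History α → Prop
  | [] => True
  | Update.insert a :: h => a ∉ History.current h ∧ History.Valid h
  | Update.delete a :: h => a ∈ History.current h ∧ History.Valid h

/-- A deterministic online coloring strategy: the coloring in force at any time is a function of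
the updates made so far. Only its values on the objects currently present matter. -/
abbrev Strategy (α : Type*) := History α → α → ℕ

/-- The number of different colors in use after the history `h`. -/
noncomputable def Strategy.numColors {α : Type*} (A : Strategy α) (h : History α) : ℕ :=
  ((History.current h).image (A h)).card

open Classical in
/-- The number of recolorings when the update `u` follows the history `h`: the number of objects
present both before and after `u` whose color changes. -/
noncomputable def Strategy.numRecolorings {α : Type*} (A : Strategy α) (u : Update α)
    (h : History α) : ℕ :=
  ((History.current h ∩ History.current (u :: h)).filter
    (fun r => A h r ≠ A (u :: h) r)).card

end DynCF

/-! Classify each rectangle by the least dyadic intervals containing its two sides. Rectangles with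
the same pair of levels that share a point lie in the same class (`dyadicClass_eq`), so classes with
equal levels can share a palette: putting only the levels into the color costs a factor of order
log² N. All rectangles of one class share a point (`exists_common_point`), so in each quadrant
around it membership of `q` depends on only two sides: a lower bound on `top` or `negBottom`, and
one on `right` or `negLeft`.

For one vertical direction, keep the rectangles of a class as leaves of a balanced 2-3 tree sorted
by the vertical key. Each subtree marks a maximizer of `f` and one of `g`, and a leaf is colored by
the highest level at which it is marked. For a range `b ≤ key`, `a ≤ k` with `k` one of `f`, `g`,
either a mark on the top level lies in it, and its label is unique, or only the subtree cut by the
threshold `b` can meet the range, and one descends (`exists_unique_color`). This uses O(log n)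
colors; pairing the two vertical directions squares that.

An update touches boundedly many nodes per level, and only leaves marked there can change color
(`exists_edit`, `exists_normalize`), which gives O(log n) recolorings. `IsDynamic` packages such
one-step guarantees; they pass to products and to partitions, and choosing a next coloring at every
step gives the online strategy. -/

namespace DynCF

-- Balanced trees as nested lists

universe u

/-- The `n`-fold nested lists over `α`; a tree all of whose leaves have depth `n`. -/
@[reducible] def Nest (α : Type u) : ℕ → Type u
  | 0 => α
  | n + 1 => List (Nest α n)

namespace Nest

variable {α : Type u}

/-- The leaves of a tree, from left to right. -/
def leaves : ∀ n : ℕ, Nest α n → List α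
  | 0, a => [a]
  | n + 1, t => List.flatMap (leaves n) t

/-- The leaves of a list of trees, from left to right. -/
def flat (n : ℕ) (F : List (Nest α n)) : List α := F.flatMap (leaves n)

/-- Every inner node has two or three children. -/
def Balanced : ∀ n : ℕ, Nest α n → Prop
  | 0, _ => True
  | n + 1, t => 2 ≤ List.length t ∧ List.length t ≤ 3 ∧ ∀ s : Nest α n, List.Mem s t → Balanced n s

lemma flat_append (n : ℕ) (F G : List (Nest α n)) : flat n (F ++ G) = flat n F ++ flat n G :=
  List.flatMap_append

lemma flat_flatten (n : ℕ) (F : List (List (Nest α n))) :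
    flat n F.flatten = flat (n + 1) F := by
  induction F with
  | nil => rfl
  | cons t F ih =>
    rw [List.flatten_cons, flat_append, ih]
    rfl

lemma flat_zero (F : List α) : flat 0 F = F := by
  induction F with
  | nil => rfl
  | cons a F ih => exact congrArg (List.cons a) ih

lemma mem_flat {n : ℕ} {F : List (Nest α n)} {r : α} : r ∈ flat n F ↔ ∃ t ∈ F, r ∈ leaves n t :=
  List.mem_flatMap

lemma eq_of_mem_leaves {n : ℕ} {F : List (Nest α n)} (hF : (flat n F).Nodup) {s t : Nest α n}
    (hs : s ∈ F) (ht : t ∈ F) {r : α} (hrs : r ∈ leaves n s) (hrt : r ∈ leaves n t) : s = t := by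
  by_contra hne
  have hd := (List.nodup_flatMap.1 hF).2
  have : Std.Symm (Function.onFun List.Disjoint (leaves (α := α) n)) :=
    ⟨fun _ _ h => List.Disjoint.symm h⟩
  exact List.Pairwise.forall hd hs ht hne hrs hrt

lemma two_pow_le_length_leaves : ∀ (n : ℕ) (t : Nest α n), Balanced n t →
    2 ^ n ≤ (leaves n t).length
  | 0, _, _ => le_rfl
  | n + 1, t, h => by
    obtain ⟨h2, -, hb⟩ := h
    have key : ∀ F : List (Nest α n), (∀ s ∈ F, Balanced n s) →
        F.length * 2 ^ n ≤ (flat n F).length := by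
      intro F
      induction F with
      | nil => simp
      | cons s F ih =>
        intro hF
        have h1 := two_pow_le_length_leaves n s (hF s (by simp))
        have h3 := ih fun s hs => hF s (by simp [hs])
        have : flat n (s :: F) = leaves n s ++ flat n F := rfl
        rw [this, List.length_append, List.length_cons]
        linarith
    calc 2 ^ (n + 1) = 2 * 2 ^ n := by ring
      _ ≤ List.length t * 2 ^ n := Nat.mul_le_mul_right _ h2
      _ ≤ _ := key t hb

/-! ### The coloring read off a tree -/

section Coloring

variable (f g : α → ℝ)

/-- The elements that maximize `f` or `g` in one of the trees of the list `F`
(one element for each tree and each function). -/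
noncomputable def winners (n : ℕ) (F : List (Nest α n)) : List α :=
  F.flatMap fun t => ((leaves n t).argmax f).toList ++ ((leaves n t).argmax g).toList

open Classical in
/-- The color of a winner: its level, the index of its tree, and which functions it maximizes. -/
noncomputable def label (n : ℕ) (F : List (Nest α n)) (r : α) : ℕ × ℕ × Bool × Bool :=
  (n, F.findIdx fun t => decide (r ∈ leaves n t),
    decide (∃ t ∈ F, r ∈ (leaves n t).argmax f), decide (∃ t ∈ F, r ∈ (leaves n t).argmax g))

open Classical in
/-- The color that `r` gets from the nodes strictly below the roots of the list of trees. -/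
noncomputable def inner : ∀ n : ℕ, List (Nest α n) → α → ℕ × ℕ × Bool × Bool
  -- Dummy value: at height 0 every leaf is a winner, so `color` never reads it for a leaf of `F`.
  | 0, _, _ => (0, 0, false, false)
  | n + 1, F, r =>
    match F.find? fun t => decide (r ∈ leaves (n + 1) t) with
    | none => (0, 0, false, false)
    | some t => if r ∈ winners f g n t then label f g n t r else inner n t r

open Classical in
/-- The color of `r`: the label at the highest level at which `r` is a winner. -/
noncomputable def color (n : ℕ) (F : List (Nest α n)) (r : α) : ℕ × ℕ × Bool × Bool :=
  if r ∈ winners f g n F then label f g n F r else inner f g n F r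

variable {f g}

lemma mem_winners {n : ℕ} {F : List (Nest α n)} {r : α} :
    r ∈ winners f g n F ↔
      ∃ t ∈ F, r ∈ (leaves n t).argmax f ∨ r ∈ (leaves n t).argmax g := by
  simp [winners, List.mem_flatMap]

lemma length_winners_le (n : ℕ) (F : List (Nest α n)) :
    (winners f g n F).length ≤ 2 * F.length := by
  have h1 : ∀ o : Option α, o.toList.length ≤ 1 := by rintro (_ | _) <;> simp
  induction F with
  | nil => simp [winners]
  | cons t F ih =>
    have : winners f g n (t :: F) =
      (((leaves n t).argmax f).toList ++ ((leaves n t).argmax g).toList) ++ winners f g n F := rfl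
    rw [this, List.length_append, List.length_append, List.length_cons]
    have := h1 ((leaves n t).argmax f)
    have := h1 ((leaves n t).argmax g)
    omega

lemma mem_winners_zero {F : List (Nest α 0)} {r : α} (hr : r ∈ flat 0 F) :
    r ∈ winners f g 0 F := by
  obtain ⟨t, ht, hrt⟩ := mem_flat.1 hr
  refine mem_winners.2 ⟨t, ht, Or.inl ?_⟩
  obtain rfl : r = t := List.mem_singleton.1 hrt
  exact rfl

lemma find?_eq_some {n : ℕ} {F : List (Nest α n)} (hF : (flat n F).Nodup) {t : Nest α n}
    (ht : t ∈ F) {r : α} (hr : r ∈ leaves n t) (p : Nest α n → Bool)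
    (hp : ∀ s, p s = true ↔ r ∈ leaves n s) : F.find? p = some t := by
  have h : (F.find? p).isSome := List.find?_isSome.2 ⟨t, ht, (hp t).2 hr⟩
  obtain ⟨s, hs⟩ := Option.isSome_iff_exists.1 h
  rw [hs, eq_of_mem_leaves hF (List.mem_of_find?_eq_some hs) ht
    ((hp s).1 (List.find?_some hs)) hr]

/-- The index determines the tree. Whichever function `r` maximizes there, the matching flag says
that `r'` does so too, and `argmax` selects a single element. -/
lemma label_injOn {n : ℕ} {F : List (Nest α n)} (hF : (flat n F).Nodup) {r r' : α}
    (hr : r ∈ winners f g n F) (hr' : r' ∈ winners f g n F)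
    (h : label f g n F r = label f g n F r') : r = r' := by
  classical
  obtain ⟨t, ht, hrt⟩ := mem_winners.1 hr
  obtain ⟨t', ht', hrt'⟩ := mem_winners.1 hr'
  have hm : r ∈ leaves n t := hrt.elim List.argmax_mem List.argmax_mem
  have hm' : r' ∈ leaves n t' := hrt'.elim List.argmax_mem List.argmax_mem
  simp only [label, Prod.mk.injEq, true_and, decide_eq_decide] at h
  obtain ⟨hi, hf, hg⟩ := h
  have e1 := find?_eq_some hF ht hm (fun t => decide (r ∈ leaves n t)) (by simp)
  have e2 := find?_eq_some hF ht' hm' (fun t => decide (r' ∈ leaves n t)) (by simp)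
  rw [List.find?_eq_getElem?_findIdx] at e1 e2
  have htt : t = t' := by
    rw [hi, e2] at e1
    exact (Option.some.inj e1).symm
  subst htt
  rcases hrt with hw | hw
  · obtain ⟨s, hs, hrs⟩ := hf.1 ⟨t, ht, hw⟩
    rw [eq_of_mem_leaves hF hs ht (List.argmax_mem hrs) hm'] at hrs
    exact Option.mem_unique hw hrs
  · obtain ⟨s, hs, hrs⟩ := hg.1 ⟨t, ht, hw⟩
    rw [eq_of_mem_leaves hF hs ht (List.argmax_mem hrs) hm'] at hrs
    exact Option.mem_unique hw hrs

open Classical in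
lemma inner_succ_eq (n : ℕ) (F : List (Nest α (n + 1))) (r : α) :
    inner f g (n + 1) F r =
      match F.find? fun t => decide (r ∈ leaves (n + 1) t) with
      | none => (0, 0, false, false)
      | some t => if r ∈ winners f g n t then label f g n t r else inner f g n t r := rfl

lemma inner_succ {n : ℕ} {F : List (List (Nest α n))} (hF : (flat (n + 1) F).Nodup)
    {t : List (Nest α n)} (ht : t ∈ F) {r : α} (hr : r ∈ flat n t) :
    inner f g (n + 1) F r = color f g n t r := by
  classical
  have := find?_eq_some (n := n + 1) hF ht hr (fun t => decide (r ∈ leaves (n + 1) t)) (by simp)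
  rw [inner_succ_eq, this]
  rfl

/-- For positive `n` this separates inner colors from the labels of level `n`. -/
lemma inner_fst_le : ∀ (n : ℕ) (F : List (Nest α n)) (r : α), (inner f g n F r).1 ≤ n - 1
  | 0, _, _ => le_rfl
  | n + 1, F, r => by
    rw [inner_succ_eq]
    split
    · simp
    · split_ifs
      · simp [label]
      · exact (inner_fst_le n _ r).trans (by omega)

lemma color_bound {b : ℕ} (hb : 3 ≤ b) : ∀ (n : ℕ) (F : List (Nest α n)), (flat n F).Nodup →
    (∀ t ∈ F, Balanced n t) → F.length ≤ b → ∀ r ∈ flat n F,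
      (color f g n F r).1 ≤ n ∧ (color f g n F r).2.1 < b := by
  classical
  intro n
  induction n with
  | zero =>
    intro F hF hbal hlen r hr
    rw [color, if_pos (mem_winners_zero hr)]
    refine ⟨le_rfl, lt_of_lt_of_le ?_ hlen⟩
    obtain ⟨t, ht, hrt⟩ := mem_flat.1 hr
    exact List.findIdx_lt_length_of_exists ⟨t, ht, by simpa using hrt⟩
  | succ n ih =>
    intro F hF hbal hlen r hr
    obtain ⟨t, ht, hrt⟩ := mem_flat.1 hr
    rw [color]
    split_ifs
    · exact ⟨le_rfl, lt_of_lt_of_le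
        (List.findIdx_lt_length_of_exists ⟨t, ht, by simpa using hrt⟩) hlen⟩
    · rw [inner_succ hF ht hrt]
      obtain ⟨-, h3, hb'⟩ := hbal t ht
      obtain ⟨h1, h2⟩ := ih t ((List.nodup_flatMap.1 hF).1 t ht) hb' (h3.trans hb) r hrt
      exact ⟨h1.trans n.le_succ, h2⟩

/-- Conflict-freeness of the coloring with respect to the ranges bounded by a lower bound on the
sorting key and a lower bound on `f` or on `g`. -/
theorem exists_unique_color {key k : α → ℝ} (hk : k = f ∨ k = g) (a b : ℝ) :
    ∀ (n : ℕ) (F : List (Nest α n)), (flat n F).Nodup →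
      (flat n F).Pairwise (fun r r' => key r ≤ key r') →
      (∃ r ∈ flat n F, b ≤ key r ∧ a ≤ k r) →
      ∃ r ∈ flat n F, (b ≤ key r ∧ a ≤ k r) ∧ ∀ r' ∈ flat n F, (b ≤ key r' ∧ a ≤ k r') →
        color f g n F r' = color f g n F r → r' = r := by
  classical
  intro n
  induction n with
  | zero =>
    rintro F hF - ⟨r, hr, hq⟩
    refine ⟨r, hr, hq, fun r' hr' _ h => ?_⟩
    rw [color, color, if_pos (mem_winners_zero hr), if_pos (mem_winners_zero hr')] at h
    exact label_injOn hF (mem_winners_zero hr') (mem_winners_zero hr) h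
  | succ n ih =>
    rintro F hF hs ⟨r, hr, hq⟩
    -- A top-level winner in the range settles the claim: other winners differ in label, and
    -- non-winners have a smaller level.
    by_cases hw : ∃ r ∈ winners f g (n + 1) F, b ≤ key r ∧ a ≤ k r
    · obtain ⟨w, hw, hwq⟩ := hw
      have hwm : w ∈ flat (n + 1) F := by
        obtain ⟨t, ht, h⟩ := mem_winners.1 hw
        exact mem_flat.2 ⟨t, ht, h.elim List.argmax_mem List.argmax_mem⟩
      refine ⟨w, hwm, hwq, fun r' hr' _ h => ?_⟩
      rw [color, color, if_pos hw] at h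
      split_ifs at h with hw'
      · exact label_injOn hF hw' hw h
      · have h1 := inner_fst_le (f := f) (g := g) (n + 1) F r'
        rw [h] at h1
        simp [label] at h1
    · push Not at hw
      obtain ⟨t, ht, hrt⟩ := mem_flat.1 hr
      -- The maximizer of `k` in such a tree is a winner, hence outside the range, and it can only
      -- fail the bound on `key`.
      have hmax : ∀ s ∈ F, ∀ z ∈ leaves (n + 1) s, a ≤ k z →
          ∃ w ∈ leaves (n + 1) s, key w < b := by
        intro s hs z hz hza
        have hne : (leaves (n + 1) s).argmax k ≠ none := by
          rw [Ne, List.argmax_eq_none]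
          exact List.ne_nil_of_mem hz
        obtain ⟨w, hw1⟩ := Option.ne_none_iff_exists'.1 hne
        refine ⟨w, List.argmax_mem hw1, ?_⟩
        by_contra! hb
        refine absurd (hza.trans (List.le_of_mem_argmax hz hw1)) (not_le.2 (hw w ?_ hb))
        refine mem_winners.2 ⟨s, hs, ?_⟩
        rcases hk with rfl | rfl
        · exact Or.inl hw1
        · exact Or.inr hw1
      have hord : ∀ s ∈ F, s ≠ t →
          (∀ x ∈ leaves (n + 1) s, ∀ y ∈ leaves (n + 1) t, key x ≤ key y) ∨
          (∀ x ∈ leaves (n + 1) t, ∀ y ∈ leaves (n + 1) s, key x ≤ key y) := by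
        intro s hsF hst
        have hp := (List.pairwise_flatMap.1 hs).2
        let R : Nest α (n + 1) → Nest α (n + 1) → Prop := fun s t =>
          (∀ x ∈ leaves (n + 1) s, ∀ y ∈ leaves (n + 1) t, key x ≤ key y) ∨
          (∀ x ∈ leaves (n + 1) t, ∀ y ∈ leaves (n + 1) s, key x ≤ key y)
        have : Std.Symm R := ⟨fun _ _ h => h.symm⟩
        have hR : F.Pairwise R := hp.imp fun h => Or.inl h
        exact List.Pairwise.forall hR hsF ht hst
      -- If two trees met the range, the later one would have a key below `b`, although all its keys
      -- are at least those of the earlier one.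
      have hone : ∀ z ∈ flat (n + 1) F, (b ≤ key z ∧ a ≤ k z) → z ∈ leaves (n + 1) t := by
        intro z hz hzq
        obtain ⟨s, hsF, hzs⟩ := mem_flat.1 hz
        by_cases hst : s = t
        · exact hst ▸ hzs
        exfalso
        rcases hord s hsF hst with h | h
        · obtain ⟨w, hwt, hwb⟩ := hmax t ht r hrt hq.2
          linarith [h z hzs w hwt, hzq.1]
        · obtain ⟨w, hwt, hwb⟩ := hmax s hsF z hzs hzq.2
          linarith [h r hrt w hwt, hq.1]
      have hcol : ∀ z ∈ leaves (n + 1) t, (b ≤ key z ∧ a ≤ k z) →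
          color f g (n + 1) F z = color f g n t z := by
        intro z hz hzq
        rw [color, if_neg fun h => absurd hzq.2 (not_le.2 (hw z h hzq.1)), inner_succ hF ht hz]
      obtain ⟨w, hwt, hwq, hu⟩ := ih t ((List.nodup_flatMap.1 hF).1 t ht)
        ((List.pairwise_flatMap.1 hs).1 t ht) ⟨r, hrt, hq⟩
      refine ⟨w, mem_flat.2 ⟨t, ht, hwt⟩, hwq, fun z hz hzq h => ?_⟩
      have hzt := hone z hz hzq
      rw [hcol z hzt hzq, hcol w hwt hwq] at h
      exact hu z hzt hzq h

end Coloring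

end Nest

/-! ### Splitting lists into blocks -/

lemma exists_regroup {β : Type*} : ∀ (k : ℕ) (l : List β), 2 * k ≤ l.length → l.length ≤ 3 * k →
    ∃ M : List (List β), M.flatten = l ∧ M.length = k ∧ ∀ c ∈ M, 2 ≤ c.length ∧ c.length ≤ 3 := by
  intro k
  induction k with
  | zero =>
    intro l _ h
    exact ⟨[], by simpa using (List.length_eq_zero_iff.1 (by omega)).symm, rfl, by simp⟩
  | succ k ih =>
    intro l h1 h2
    obtain ⟨j, hj2, hj3, ha, hb⟩ : ∃ j, 2 ≤ j ∧ j ≤ 3 ∧ 2 * k ≤ l.length - j ∧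
        l.length - j ≤ 3 * k := by
      by_cases h : l.length ≤ 3 * k + 2
      · exact ⟨2, by omega, by omega, by omega, by omega⟩
      · exact ⟨3, by omega, by omega, by omega, by omega⟩
    obtain ⟨M, hM, hk, hc⟩ := ih (l.drop j) (by simpa using ha) (by simpa using hb)
    refine ⟨l.take j :: M, by simp [hM], by simp [hk], ?_⟩
    intro c hc'
    rcases List.mem_cons.1 hc' with rfl | h
    · rw [List.length_take]
      omega
    · exact hc c h

lemma exists_block_of_flatten_eq {β : Type*} {F : List (List β)} {A C : List β} {p : β}
    (h : F.flatten = A ++ p :: C) :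
    ∃ A' a b B', F = A' ++ (a ++ p :: b) :: B' ∧ A = A'.flatten ++ a ∧ C = b ++ B'.flatten := by
  rcases List.flatten_eq_append_iff.1 h with ⟨as, bs, rfl, rfl, h2⟩ | ⟨as, bs, c, cs, ds, rfl, rfl, h2⟩
  · obtain ⟨as', b, cs, rfl, h3, rfl⟩ := List.flatten_eq_cons_iff.1 h2.symm
    refine ⟨as ++ as', [], b, cs, by simp, ?_, rfl⟩
    rw [List.flatten_append, List.flatten_eq_nil_iff.2 h3, List.append_nil, List.append_nil]
  · rw [List.cons_append, List.cons.injEq] at h2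
    obtain ⟨rfl, rfl⟩ := h2
    exact ⟨as, bs, cs, ds, rfl, rfl, rfl⟩

/-- Two adjacent entries lie in one block or in two consecutive ones, because no empty block can
separate them. This keeps the edited stretch at most two trees wide on the way up. -/
lemma exists_blocks_of_flatten_eq {β : Type*} {F : List (List β)} (hF : ∀ c ∈ F, c ≠ [])
    {A P B : List β} (h : F.flatten = A ++ P ++ B) (h1 : 1 ≤ P.length) (h2 : P.length ≤ 2) :
    ∃ A' M B' a b, F = A' ++ M ++ B' ∧ 1 ≤ M.length ∧ M.length ≤ 2 ∧
      A = A'.flatten ++ a ∧ B = b ++ B'.flatten ∧ M.flatten = a ++ P ++ b := by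
  match P, h1, h2 with
  | [p], _, _ =>
    obtain ⟨A', a, b, B', rfl, hA, hB⟩ := exists_block_of_flatten_eq (A := A) (p := p) (C := B)
      (by simpa using h)
    exact ⟨A', [a ++ p :: b], B', a, b, by simp, by simp, by simp, hA, hB, by simp⟩
  | [p, q], _, _ =>
    obtain ⟨A', a, b, B', rfl, hA, hB⟩ := exists_block_of_flatten_eq (A := A) (p := p)
      (C := q :: B) (by simpa using h)
    match b, hB with
    | q' :: b, hB =>
      rw [List.cons_append, List.cons.injEq] at hB
      obtain ⟨rfl, hB⟩ := hB
      exact ⟨A', [a ++ p :: q :: b], B', a, b, by simp, by simp, by simp, hA, hB, by simp⟩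
    | [], hB =>
      match B', hB, hF with
      | [] :: B', _, hF => exact absurd rfl (hF [] (by simp))
      | (d :: b) :: B', hB, hF =>
        rw [List.nil_append, List.flatten_cons, List.cons_append, List.cons.injEq] at hB
        obtain ⟨rfl, hB⟩ := hB
        exact ⟨A', [a ++ [p], q :: b], B', a, b, by simp, by simp, by simp, hA, hB, by simp⟩

/-! ### Updating a tree -/

namespace Nest

variable {α : Type u} {f g : α → ℝ}

lemma balanced_of_flatten {n : ℕ} {F : List (List (Nest α n))}
    (hF : ∀ t ∈ F, Balanced (n + 1) t) : ∀ s ∈ F.flatten, Balanced n s := by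
  intro s hs
  obtain ⟨t, ht, hst⟩ := List.mem_flatten.1 hs
  exact (hF t ht).2.2 s hst

lemma length_flatten_bounds {n : ℕ} : ∀ {F : List (List (Nest α n))},
    (∀ t ∈ F, Balanced (n + 1) t) →
      2 * F.length ≤ F.flatten.length ∧ F.flatten.length ≤ 3 * F.length
  | [], _ => by simp
  | t :: F, h => by
    have ih := length_flatten_bounds (F := F) fun s hs => h s (by simp [hs])
    obtain ⟨h2, h3, -⟩ := h t (by simp)
    rw [List.flatten_cons, List.length_append, List.length_cons]
    omega

lemma winners_subset_flatten {n : ℕ} {F : List (List (Nest α n))} {t : List (Nest α n)}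
    (ht : t ∈ F) {r : α} (hr : r ∈ winners f g n t) : r ∈ winners f g n F.flatten := by
  obtain ⟨s, hs, h⟩ := mem_winners.1 hr
  exact mem_winners.2 ⟨s, List.mem_flatten.2 ⟨t, ht, hs⟩, h⟩

lemma inner_flatten {n : ℕ} {F : List (List (Nest α n))} (hF : (flat (n + 1) F).Nodup)
    {t : List (Nest α n)} (ht : t ∈ F) {r : α} (hr : r ∈ flat n t) :
    inner f g n F.flatten r = inner f g n t r := by
  cases n with
  | zero => rfl
  | succ n =>
    obtain ⟨s, hs, hrs⟩ := mem_flat.1 hr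
    have hF' : (flat (n + 1) F.flatten).Nodup := by rwa [flat_flatten]
    rw [inner_succ hF' (List.mem_flatten.2 ⟨t, ht, hs⟩) hrs,
      inner_succ ((List.nodup_flatMap.1 hF).1 t ht) hs hrs]

/-- For a non-winner one level down, the inner color only depends on the next level. -/
lemma inner_succ_eq_inner_flatten {n : ℕ} {F : List (List (Nest α n))}
    (hF : (flat (n + 1) F).Nodup) {t : List (Nest α n)} (ht : t ∈ F) {r : α}
    (hr : r ∈ flat n t) (hw : r ∉ winners f g n t) :
    inner f g (n + 1) F r = inner f g n F.flatten r := by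
  rw [inner_succ hF ht hr, inner_flatten hF ht hr, color, if_neg hw]

/-- Replacing the leaf `x` by at most two leaves changes at most two adjacent trees, and changes
few inner colors. -/
theorem exists_edit {x : α} {m : List α} (hm : m.length ≤ 2) :
    ∀ (n : ℕ) (F : List (Nest α n)) (l₁ l₂ : List α), (∀ t ∈ F, Balanced n t) →
      (n = 0 ∨ 2 ≤ F.length) → (flat n F).Nodup → flat n F = l₁ ++ x :: l₂ →
      (l₁ ++ m ++ l₂).Nodup →
      ∃ A P B P' : List (Nest α n), F = A ++ P ++ B ∧ 1 ≤ P.length ∧ P.length ≤ 2 ∧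
        P.length ≤ P'.length + 1 ∧ P'.length ≤ P.length + 1 ∧ (∀ t ∈ P', Balanced n t) ∧
        flat n (A ++ P' ++ B) = l₁ ++ m ++ l₂ ∧
        ∃ X : List α, X.length ≤ 30 * n ∧ ∀ r ∈ flat n F, r ∈ flat n (A ++ P' ++ B) → r ∉ X →
          inner f g n F r = inner f g n (A ++ P' ++ B) r := by
  intro n
  induction n with
  | zero =>
    intro F l₁ l₂ _ _ _ hfl _
    rw [flat_zero] at hfl
    exact ⟨l₁, [x], l₂, m, by simpa using hfl, by simp, by simp, by simp, by simpa using hm,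
      fun _ _ => trivial, flat_zero _, [], by simp, fun _ _ _ _ => rfl⟩
  | succ n ih =>
    intro F l₁ l₂ hbal hlen hnd hfl hnd'
    have hlen : 2 ≤ F.length := hlen.resolve_left n.succ_ne_zero
    obtain ⟨A, P, B, P', hG, hP1, hP2, hPP', hP'P, hP'b, hfl', X, hX, hin⟩ :=
      ih F.flatten l₁ l₂ (balanced_of_flatten hbal)
        (Or.inr (by have := (length_flatten_bounds hbal).1; omega))
        (by rwa [flat_flatten]) (by rwa [flat_flatten]) hnd'
    have hne : ∀ c ∈ F, c ≠ [] := by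
      rintro c hc rfl
      have := (hbal [] hc).1
      simp at this
    -- The new children must suffice for at least one legal node. The only bad case is a single node
    -- left with one child; it then borrows an adjacent sibling, which exists as `2 ≤ F.length`.
    obtain ⟨A', M, B', a, b, hF, hM1, hM2, hA, hB, hM, hMP⟩ :
        ∃ A' M B' a b, F = A' ++ M ++ B' ∧ 1 ≤ M.length ∧ M.length ≤ 2 ∧
          A = A'.flatten ++ a ∧ B = b ++ B'.flatten ∧ M.flatten = a ++ P ++ b ∧
          2 ≤ (a ++ P' ++ b).length := by
      obtain ⟨A', M, B', a, b, hF, hM1, hM2, hA, hB, hM⟩ :=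
        exists_blocks_of_flatten_eq hne hG hP1 hP2
      by_cases h2 : 2 ≤ (a ++ P' ++ b).length
      · exact ⟨A', M, B', a, b, hF, hM1, hM2, hA, hB, hM, h2⟩
      have hMl := (length_flatten_bounds (F := M) fun t ht => hbal t (by simp [hF, ht])).1
      rw [hM] at hMl
      simp only [List.length_append] at hMl h2
      have hM1' : M.length = 1 := by omega
      rcases List.eq_nil_or_concat A' with rfl | ⟨A'', c, rfl⟩
      · match B', hF, hB with
        | [], hF, hB => simp [hF] at hlen; omega
        | c :: B', hF, hB =>
          have hc := (hbal c (by simp [hF])).1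
          refine ⟨[], M ++ [c], B', a, b ++ c, by simp [hF], by simp, by simp [hM1'], hA,
            by simp [hB], by simp [hM], ?_⟩
          simp only [List.length_append]
          omega
      · have hc := (hbal c (by simp [hF])).1
        refine ⟨A'', c :: M, B', c ++ a, b, by simp [hF], by simp, by simp [hM1'],
            by simp [hA], hB, by simp [hM], ?_⟩
        simp only [List.length_append]
        omega
    obtain ⟨hMl2, hMl3⟩ := length_flatten_bounds (F := M) fun t ht => hbal t (by simp [hF, ht])
    have hL : (a ++ P ++ b).length ≤ (a ++ P' ++ b).length + 1 ∧
        (a ++ P' ++ b).length ≤ (a ++ P ++ b).length + 1 := by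
      simp only [List.length_append]
      omega
    -- The number of children changed by at most one, so at most one node must be merged away or
    -- split off.
    obtain ⟨k, hk2, hk3, hk4, hk5⟩ : ∃ k, 2 * k ≤ (a ++ P' ++ b).length ∧
        (a ++ P' ++ b).length ≤ 3 * k ∧ M.length ≤ k + 1 ∧ k ≤ M.length + 1 := by
      rw [hM] at hMl2 hMl3
      by_cases h : (a ++ P' ++ b).length < 2 * M.length
      · exact ⟨M.length - 1, by omega, by omega, by omega, by omega⟩
      by_cases h' : (a ++ P' ++ b).length ≤ 3 * M.length
      · exact ⟨M.length, by omega, by omega, by omega, by omega⟩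
      · exact ⟨M.length + 1, by omega, by omega, by omega, by omega⟩
    obtain ⟨M', hM', hM'k, hM'c⟩ := exists_regroup k _ hk2 hk3
    have hflat : (A' ++ M' ++ B').flatten = A ++ P' ++ B := by simp [hM', hA, hB]
    have hfl'' : flat (n + 1) (A' ++ M' ++ B') = l₁ ++ m ++ l₂ := by
      rw [← flat_flatten, hflat, hfl']
    have hnd'' : (flat (n + 1) (A' ++ M' ++ B')).Nodup := by rwa [hfl'']
    refine ⟨A', M, B', M', hF, hM1, hM2, by omega, by omega, ?_, hfl'',
      X ++ winners f g n M.flatten ++ winners f g n M'.flatten, ?_, ?_⟩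
    · intro t ht
      refine ⟨(hM'c t ht).1, (hM'c t ht).2, fun s hs => ?_⟩
      have hs' : s ∈ M'.flatten := List.mem_flatten.2 ⟨t, ht, hs⟩
      rw [hM'] at hs'
      have hmem : s ∈ P' ∨ s ∈ M.flatten := by
        rw [hM]
        simp only [List.mem_append] at hs' ⊢
        tauto
      rcases hmem with h | h
      · exact hP'b s h
      · obtain ⟨t', ht', hst'⟩ := List.mem_flatten.1 h
        exact (hbal t' (by simp [hF, ht'])).2.2 s hst'
    -- At most 6 old and 7 new children, with two winners each: 12 + 14 ≤ 30.
    · have h1 := length_winners_le (f := f) (g := g) n M.flatten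
      have h2 := length_winners_le (f := f) (g := g) n M'.flatten
      rw [hM'] at h2
      rw [hM] at h1 hMl3
      rw [hM, hM', List.length_append, List.length_append]
      omega
    · intro r hr hr' hrX
      simp only [List.mem_append, not_or] at hrX
      obtain ⟨⟨hrX, hrM⟩, hrM'⟩ := hrX
      obtain ⟨t, ht, hrt⟩ := mem_flat.1 hr
      obtain ⟨t', ht', hrt'⟩ := mem_flat.1 hr'
      -- A leaf in an unedited tree keeps its inner color. The remaining leaves are non-winners
      -- among the children before and after, so their color comes from one level lower.
      by_cases h : t' ∈ A' ∨ t' ∈ B'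
      · have htF : t' ∈ F := by
          rw [hF]
          simp only [List.mem_append]
          tauto
        rw [inner_succ hnd htF hrt', inner_succ hnd'' ht' hrt']
      by_cases h' : t ∈ A' ∨ t ∈ B'
      · have htF : t ∈ A' ++ M' ++ B' := by
          simp only [List.mem_append]
          tauto
        rw [inner_succ hnd ht hrt, inner_succ hnd'' htF hrt]
      have htM : t ∈ M := by
        rw [hF] at ht
        simp only [List.mem_append] at ht
        tauto
      have htM' : t' ∈ M' := by
        simp only [List.mem_append] at ht'
        tauto
      rw [inner_succ_eq_inner_flatten hnd ht hrt fun hw => hrM (winners_subset_flatten htM hw),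
        inner_succ_eq_inner_flatten hnd'' ht' hrt' fun hw => hrM' (winners_subset_flatten htM' hw),
        hflat]
      refine hin r ?_ ?_ hrX
      · rwa [flat_flatten]
      · rwa [← hflat, flat_flatten]

/-- A list of at most four balanced trees can be turned into one of two or three balanced trees
(or of at most three leaves), possibly of another height. -/
lemma exists_normalize (n : ℕ) (F : List (Nest α n)) (hbal : ∀ t ∈ F, Balanced n t)
    (hnd : (flat n F).Nodup) (h4 : F.length ≤ 4) (h1 : n = 0 ∨ 1 ≤ F.length) :
    ∃ (n' : ℕ) (F' : List (Nest α n')), (∀ t ∈ F', Balanced n' t) ∧ F'.length ≤ 3 ∧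
      (n' = 0 ∨ 2 ≤ F'.length) ∧ flat n' F' = flat n F ∧
      ∃ X : List α, X.length ≤ 14 ∧ ∀ r ∈ flat n F, r ∉ X →
        inner f g n F r = color f g n' F' r := by
  by_cases hlow : n = 0 ∨ 2 ≤ F.length
  · by_cases hhigh : F.length ≤ 3
    · refine ⟨n, F, hbal, hhigh, hlow, rfl, winners f g n F, ?_, fun r _ hr => ?_⟩
      · have := length_winners_le (f := f) (g := g) n F
        omega
      · rw [color, if_neg hr]
    -- Four trees: pair them up and raise the height by one.
    · obtain ⟨a, b, c, d, rfl⟩ : ∃ a b c d, F = [a, b, c, d] := by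
        have h : F.length = 4 := by omega
        clear * - h
        match F, h with
        | [a, b, c, d], _ => exact ⟨a, b, c, d, rfl⟩
      have hfl : flat (n + 1) [[a, b], [c, d]] = flat n [a, b, c, d] := by
        rw [← flat_flatten]
        rfl
      have hnd' : (flat (n + 1) [[a, b], [c, d]]).Nodup := by rwa [hfl]
      refine ⟨n + 1, [[a, b], [c, d]], ?_, by simp, by simp, hfl,
        winners f g (n + 1) [[a, b], [c, d]] ++ winners f g n [a, b, c, d], ?_, ?_⟩
      · intro t ht
        have : t = [a, b] ∨ t = [c, d] := by simpa using ht
        rcases this with rfl | rfl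
        · exact ⟨by simp, by simp, fun s hs => hbal s (by
            have : s = a ∨ s = b := by simpa using (show s ∈ [a, b] from hs)
            rcases this with rfl | rfl <;> simp)⟩
        · exact ⟨by simp, by simp, fun s hs => hbal s (by
            have : s = c ∨ s = d := by simpa using (show s ∈ [c, d] from hs)
            rcases this with rfl | rfl <;> simp)⟩
      · have h2 := length_winners_le (f := f) (g := g) n [a, b, c, d]
        have h3 := length_winners_le (f := f) (g := g) (n + 1) [[a, b], [c, d]]
        rw [List.length_append]
        simp only [List.length_cons, List.length_nil] at h2 h3
        omega
      · intro r hr hrX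
        simp only [List.mem_append, not_or] at hrX
        rw [← hfl] at hr
        obtain ⟨t, ht, hrt⟩ := mem_flat.1 hr
        rw [color, if_neg hrX.1, inner_succ_eq_inner_flatten hnd' ht hrt fun hw => hrX.2 ?_]
        · rfl
        · exact winners_subset_flatten (F := [[a, b], [c, d]]) ht hw
  -- A single tree of positive height: drop its root and lower the height by one.
  · push Not at hlow
    obtain ⟨hn, hlt⟩ := hlow
    obtain ⟨k, rfl⟩ := Nat.exists_eq_succ_of_ne_zero hn
    match F, h1.resolve_left hn, hlt with
    | [t], _, _ =>
      have hfl : flat k t = flat (k + 1) [t] := by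
        rw [← flat_flatten, List.flatten_singleton]
      obtain ⟨h2, h3, hb⟩ := hbal t (by simp)
      refine ⟨k, t, hb, h3, Or.inr h2, hfl, [], by simp, fun r hr _ => ?_⟩
      exact inner_succ hnd (by simp) (hfl ▸ hr)

end Nest

/-! ### Colorings of finite sets given by trees -/

section Represents

variable {α : Type u}

/-- The coloring `c` of `S` is given by a balanced tree whose leaves are the elements of `S`,
sorted by `key`. -/
def Represents (key f g : α → ℝ) (S : Finset α) (c : α → ℕ × ℕ × Bool × Bool) : Prop :=
  ∃ (n : ℕ) (F : List (Nest α n)), (∀ t ∈ F, Nest.Balanced n t) ∧ F.length ≤ 3 ∧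
    (n = 0 ∨ 2 ≤ F.length) ∧ (Nest.flat n F).Nodup ∧
    (Nest.flat n F).Pairwise (fun r r' => key r ≤ key r') ∧
    (∀ r, r ∈ Nest.flat n F ↔ r ∈ S) ∧ ∀ r ∈ S, c r = Nest.color f g n F r

lemma card_eq_length {l : List α} (hl : l.Nodup) {S : Finset α} (h : ∀ r, r ∈ l ↔ r ∈ S) :
    S.card = l.length := by
  classical
  have : S = l.toFinset := by
    ext r
    rw [List.mem_toFinset, h]
  rw [this, List.toFinset_card_of_nodup hl]

lemma Nest.le_log_length_flat {n : ℕ} {F : List (Nest α n)} (hb : ∀ t ∈ F, Balanced n t)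
    (h : n = 0 ∨ 2 ≤ F.length) : n ≤ Nat.log 2 (flat n F).length := by
  rcases h with rfl | h
  · exact Nat.zero_le _
  match F, h with
  | t :: F, _ =>
    refine Nat.le_log_of_pow_le one_lt_two
      ((two_pow_le_length_leaves n t (hb t (by simp))).trans ?_)
    have : flat n (t :: F) = leaves n t ++ flat n F := rfl
    rw [this, List.length_append]
    exact Nat.le_add_right _ _

variable {key f g : α → ℝ} {S : Finset α} {c : α → ℕ × ℕ × Bool × Bool}

lemma Represents.exists_unique (h : Represents key f g S c) {k : α → ℝ} (hk : k = f ∨ k = g)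
    (a b : ℝ) (hne : ∃ r ∈ S, b ≤ key r ∧ a ≤ k r) :
    ∃ r ∈ S, (b ≤ key r ∧ a ≤ k r) ∧ ∀ r' ∈ S, (b ≤ key r' ∧ a ≤ k r') → c r' = c r → r' = r := by
  obtain ⟨n, F, -, -, -, hnd, hs, hmem, hc⟩ := h
  obtain ⟨r₀, hr₀, hq₀⟩ := hne
  obtain ⟨r, hr, hq, hu⟩ := Nest.exists_unique_color hk a b n F hnd hs ⟨r₀, (hmem r₀).2 hr₀, hq₀⟩
  refine ⟨r, (hmem r).1 hr, hq, fun r' hr' hq' he => hu r' ((hmem r').2 hr') hq' ?_⟩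
  rwa [← hc r' hr', ← hc r ((hmem r).1 hr)]

lemma Represents.color_bound (h : Represents key f g S c) {r : α} (hr : r ∈ S) :
    (c r).1 ≤ Nat.log 2 S.card ∧ (c r).2.1 < 3 := by
  obtain ⟨n, F, hb, h3, h2, hnd, -, hmem, hc⟩ := h
  have := Nest.color_bound (f := f) (g := g) le_rfl n F hnd hb h3 r ((hmem r).2 hr)
  rw [hc r hr, card_eq_length hnd hmem]
  exact ⟨this.1.trans (Nest.le_log_length_flat hb h2), this.2⟩

lemma represents_empty (c : α → ℕ × ℕ × Bool × Bool) : Represents key f g ∅ c :=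
  ⟨0, [], by simp, by simp, by simp, by simp [Nest.flat], by simp [Nest.flat],
    by simp [Nest.flat], by simp⟩

lemma Represents.congr (h : Represents key f g S c) {c' : α → ℕ × ℕ × Bool × Bool}
    (hcc' : ∀ r ∈ S, c r = c' r) : Represents key f g S c' := by
  obtain ⟨n, F, hb, h3, h2, hnd, hs, hmem, hc⟩ := h
  exact ⟨n, F, hb, h3, h2, hnd, hs, hmem, fun r hr => (hcc' r hr).symm.trans (hc r hr)⟩

/-- The exceptional set consists of 30 leaves per level from the edit, at most 6 winners of the old
top level, and 14 leaves from normalizing the new one. -/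
lemma exists_represents_of_replace {n : ℕ} {F : List (Nest α n)}
    (hb : ∀ t ∈ F, Nest.Balanced n t) (h3 : F.length ≤ 3) (h2 : n = 0 ∨ 2 ≤ F.length)
    (hnd : (Nest.flat n F).Nodup) (hmem : ∀ r, r ∈ Nest.flat n F ↔ r ∈ S)
    (hc : ∀ r ∈ S, c r = Nest.color f g n F r) {x : α} {l₁ l₂ m : List α} (hm : m.length ≤ 2)
    (hfl : Nest.flat n F = l₁ ++ x :: l₂) (hnd' : (l₁ ++ m ++ l₂).Nodup)
    (hs' : (l₁ ++ m ++ l₂).Pairwise (fun r r' => key r ≤ key r')) {S' : Finset α}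
    (hmem' : ∀ r, r ∈ l₁ ++ m ++ l₂ ↔ r ∈ S') :
    ∃ c', Represents key f g S' c' ∧ ∃ X : List α, X.length ≤ 30 * Nat.log 2 S.card + 20 ∧
      ∀ r ∈ S, r ∈ S' → r ∉ X → c r = c' r := by
  obtain ⟨A, P, B, P', hF, -, -, hPP', hP'P, hP'b, hfl', X, hX, hin⟩ :=
    Nest.exists_edit (f := f) (g := g) hm n F l₁ l₂ hb h2 hnd hfl hnd'
  have hlen : F.length = A.length + P.length + B.length := by
    rw [hF, List.length_append, List.length_append]
  have hlen' : (A ++ P' ++ B).length = A.length + P'.length + B.length := by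
    rw [List.length_append, List.length_append]
  obtain ⟨n', F', hb', h3', h2', hfl'', X', hX', hin'⟩ :=
    Nest.exists_normalize (f := f) (g := g) n (A ++ P' ++ B) (by
        intro t ht
        simp only [List.mem_append] at ht
        rcases ht with (ht | ht) | ht
        · exact hb t (by simp [hF, ht])
        · exact hP'b t ht
        · exact hb t (by simp [hF, ht]))
      (by rwa [hfl']) (by omega) (by omega)
  refine ⟨Nest.color f g n' F', ⟨n', F', hb', h3', h2', ?_, ?_, ?_, fun _ _ => rfl⟩,
    X ++ Nest.winners f g n F ++ X', ?_, ?_⟩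
  · rwa [hfl'', hfl']
  · rwa [hfl'', hfl']
  · rwa [hfl'', hfl']
  · have hn := Nest.le_log_length_flat hb h2
    rw [← card_eq_length hnd hmem] at hn
    have := Nest.length_winners_le (f := f) (g := g) n F
    simp only [List.length_append]
    omega
  · intro r hr hr' hrX
    simp only [List.mem_append, not_or] at hrX
    have hr'' : r ∈ Nest.flat n (A ++ P' ++ B) := by rwa [hfl', hmem']
    rw [hc r hr, Nest.color, if_neg hrX.1.2, hin r ((hmem r).2 hr) hr'' hrX.1.1,
      hin' r hr'' hrX.2]

lemma exists_sorted_insert (key : α → ℝ) (y : α) : ∀ l : List α,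
    l.Pairwise (fun r r' => key r ≤ key r') →
    ∃ l₁ l₂, l = l₁ ++ l₂ ∧ (l₁ ++ y :: l₂).Pairwise (fun r r' => key r ≤ key r')
  | [], _ => ⟨[], [], rfl, by simp⟩
  | a :: l, h => by
    by_cases hya : key y ≤ key a
    · refine ⟨[], a :: l, rfl, List.pairwise_cons.2 ⟨fun b hb => ?_, h⟩⟩
      rcases List.mem_cons.1 hb with rfl | hb
      · exact hya
      · exact hya.trans ((List.pairwise_cons.1 h).1 b hb)
    · obtain ⟨l₁, l₂, rfl, hs⟩ := exists_sorted_insert key y l (List.pairwise_cons.1 h).2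
      refine ⟨a :: l₁, l₂, rfl, List.pairwise_cons.2 ⟨fun b hb => ?_, hs⟩⟩
      have hb' : b = y ∨ b ∈ l₁ ++ l₂ := by
        have hb : b ∈ l₁ ++ y :: l₂ := hb
        simp only [List.mem_append, List.mem_cons] at hb ⊢
        tauto
      rcases hb' with rfl | hb'
      · exact (not_le.1 hya).le
      · exact (List.pairwise_cons.1 h).1 b hb'

-- Insertion is the replacement of a neighbor `x` by two leaves: `[y, x]` if some leaf follows `y`,
-- and `[x, y]` if `y` comes last. The empty set has no neighbor and starts a new tree.
open Classical in
lemma Represents.exists_insert (h : Represents key f g S c) {y : α} (hy : y ∉ S) :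
    ∃ c', Represents key f g (insert y S) c' ∧ ∃ X : List α,
      X.length ≤ 30 * Nat.log 2 S.card + 20 ∧ ∀ r ∈ S, r ∉ X → c r = c' r := by
  obtain ⟨n, F, hb, h3, h2, hnd, hs, hmem, hc⟩ := h
  obtain ⟨l₁, l₂, hl, hs'⟩ := exists_sorted_insert key y _ hs
  have hmem' : ∀ r, r ∈ l₁ ++ y :: l₂ ↔ r ∈ insert y S := by
    intro r
    rw [Finset.mem_insert, ← hmem, hl]
    simp only [List.mem_append, List.mem_cons]
    tauto
  have hnd' : (l₁ ++ y :: l₂).Nodup := by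
    rw [List.nodup_middle, ← hl, List.nodup_cons, hmem]
    exact ⟨hy, hnd⟩
  have hsub : ∀ c', Represents key f g (insert y S) c' → ∀ X : List α,
      X.length ≤ 30 * Nat.log 2 S.card + 20 →
      (∀ r ∈ S, r ∈ insert y S → r ∉ X → c r = c' r) → ∃ c', Represents key f g (insert y S) c' ∧
      ∃ X : List α, X.length ≤ 30 * Nat.log 2 S.card + 20 ∧ ∀ r ∈ S, r ∉ X → c r = c' r :=
    fun c' hc' X hX h => ⟨c', hc', X, hX, fun r hr => h r hr (Finset.mem_insert_of_mem hr)⟩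
  match l₂, hl, hs', hmem', hnd' with
  | x :: l₂, hl, hs', hmem', hnd' =>
    have e : l₁ ++ [y, x] ++ l₂ = l₁ ++ y :: x :: l₂ := by simp
    obtain ⟨c', hc', X, hX, hX'⟩ := exists_represents_of_replace (m := [y, x]) hb h3 h2 hnd hmem hc
      (by simp) hl (by rwa [e]) (by rwa [e]) (by rwa [e])
    exact hsub c' hc' X hX hX'
  | [], hl, hs', hmem', hnd' =>
    rcases List.eq_nil_or_concat l₁ with rfl | ⟨l, x, rfl⟩
    · have hS : S = ∅ := by
        ext r
        rw [← hmem, hl]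
        simp
      subst hS
      refine ⟨Nest.color f g 0 [y], ⟨0, [y], fun _ _ => trivial, by simp, by simp, ?_, ?_, ?_,
        fun _ _ => rfl⟩, [], by simp, by simp⟩
      · simp [Nest.flat_zero]
      · simp [Nest.flat_zero]
      · simp [Nest.flat_zero]
    · have e : l ++ [x, y] ++ [] = l.concat x ++ [y] := by simp
      obtain ⟨c', hc', X, hX, hX'⟩ := exists_represents_of_replace (m := [x, y]) (l₁ := l)
        (l₂ := []) (x := x) hb h3 h2 hnd hmem hc
        (by simp) (by simpa using hl) (by rwa [e]) (by rwa [e]) (by rwa [e])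
      exact hsub c' hc' X hX hX'

open Classical in
lemma Represents.exists_erase (h : Represents key f g S c) {x : α} (hx : x ∈ S) :
    ∃ c', Represents key f g (S.erase x) c' ∧ ∃ X : List α,
      X.length ≤ 30 * Nat.log 2 S.card + 20 ∧ ∀ r ∈ S.erase x, r ∉ X → c r = c' r := by
  obtain ⟨n, F, hb, h3, h2, hnd, hs, hmem, hc⟩ := h
  obtain ⟨l₁, l₂, hl⟩ := List.append_of_mem ((hmem x).2 hx)
  have hsub : (l₁ ++ [] ++ l₂).Sublist (Nest.flat n F) := by
    rw [hl]
    simp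
  have hx' : x ∉ l₁ ++ l₂ := by
    rw [hl, List.nodup_middle] at hnd
    exact (List.nodup_cons.1 hnd).1
  obtain ⟨c', hc', X, hX, hX'⟩ := exists_represents_of_replace (m := []) (S' := S.erase x)
    hb h3 h2 hnd hmem hc (by simp) hl (hnd.sublist hsub) (hs.sublist hsub) (by
      intro r
      rw [Finset.mem_erase, ← hmem, hl]
      by_cases hr : r = x
      · subst hr
        simpa using hx'
      · simp [hr])
  exact ⟨c', hc', X, hX, fun r hr => hX' r (Finset.mem_of_mem_erase hr) hr⟩

end Represents

/-! ### From single updates to online strategies -/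

section Dynamic

variable {α : Type u} {γ : Type*}

open Classical in
/-- Colorings satisfying `R` can be maintained under updates with at most `d m` recolorings
per update, where `m` is the number of objects after the update. -/
structure IsDynamic (R : Finset α → (α → γ) → Prop) (d : ℕ → ℕ) : Prop where
  empty : ∀ c, R ∅ c
  congr : ∀ {S c c'}, R S c → (∀ r ∈ S, c r = c' r) → R S c'
  exists_insert : ∀ {S c x}, R S c → x ∉ S → ∃ c', R (insert x S) c' ∧
    ∃ X : List α, X.length ≤ d (S.card + 1) ∧ ∀ r ∈ S, r ∉ X → c r = c' r
  exists_erase : ∀ {S c x}, R S c → x ∈ S → ∃ c', R (S.erase x) c' ∧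
    ∃ X : List α, X.length ≤ d (S.card - 1) ∧ ∀ r ∈ S.erase x, r ∉ X → c r = c' r

/-- The tree bounds use the size before the update, which exceeds the final size by one after a
deletion; hence `m + 1`. -/
lemma isDynamic_represents (key f g : α → ℝ) :
    IsDynamic (Represents key f g) fun m => 30 * Nat.log 2 (m + 1) + 20 where
  empty := represents_empty
  congr h := h.congr
  exists_insert {S c x} h hx := by
    obtain ⟨c', hc', X, hX, h⟩ := h.exists_insert hx
    refine ⟨c', hc', X, hX.trans ?_, h⟩
    have := Nat.log_mono_right (b := 2) (show S.card ≤ S.card + 1 + 1 by omega)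
    omega
  exists_erase {S c x} h hx := by
    obtain ⟨c', hc', X, hX, h⟩ := h.exists_erase hx
    refine ⟨c', hc', X, hX.trans ?_, h⟩
    have := Nat.log_mono_right (b := 2) (show S.card ≤ S.card - 1 + 1 by omega)
    omega

lemma IsDynamic.prod {δ : Type*} {R : Finset α → (α → γ) → Prop} {R' : Finset α → (α → δ) → Prop}
    {d d' : ℕ → ℕ} (h : IsDynamic R d) (h' : IsDynamic R' d') :
    IsDynamic (fun S (c : α → γ × δ) => R S (fun r => (c r).1) ∧ R' S fun r => (c r).2)
      fun m => d m + d' m where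
  empty c := ⟨h.empty _, h'.empty _⟩
  congr hc hcc' := ⟨h.congr hc.1 fun r hr => congrArg Prod.fst (hcc' r hr),
    h'.congr hc.2 fun r hr => congrArg Prod.snd (hcc' r hr)⟩
  exists_insert {S c x} hc hx := by
    obtain ⟨c₁, hc₁, X₁, hX₁, hr₁⟩ := h.exists_insert hc.1 hx
    obtain ⟨c₂, hc₂, X₂, hX₂, hr₂⟩ := h'.exists_insert hc.2 hx
    refine ⟨fun r => (c₁ r, c₂ r), ⟨hc₁, hc₂⟩, X₁ ++ X₂, ?_, fun r hr hrX => ?_⟩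
    · rw [List.length_append]
      exact Nat.add_le_add hX₁ hX₂
    · rw [List.mem_append, not_or] at hrX
      exact Prod.ext (hr₁ r hr hrX.1) (hr₂ r hr hrX.2)
  exists_erase {S c x} hc hx := by
    obtain ⟨c₁, hc₁, X₁, hX₁, hr₁⟩ := h.exists_erase hc.1 hx
    obtain ⟨c₂, hc₂, X₂, hX₂, hr₂⟩ := h'.exists_erase hc.2 hx
    refine ⟨fun r => (c₁ r, c₂ r), ⟨hc₁, hc₂⟩, X₁ ++ X₂, ?_, fun r hr hrX => ?_⟩
    · rw [List.length_append]
      exact Nat.add_le_add hX₁ hX₂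
    · rw [List.mem_append, not_or] at hrX
      exact Prod.ext (hr₁ r hr hrX.1) (hr₂ r hr hrX.2)

open Classical in
/-- Colorings can be maintained separately in each of the classes of a partition. -/
lemma IsDynamic.classes {κ : Type*} {R : Finset α → (α → γ) → Prop} {d : ℕ → ℕ}
    (h : IsDynamic R d) (hd : Monotone d) (cl : α → κ) :
    IsDynamic (fun S c => ∀ k, R (S.filter fun r => cl r = k) c) d where
  empty c k := by simpa using h.empty c
  congr hc hcc' k := h.congr (hc k) fun r hr => hcc' r (Finset.mem_filter.1 hr).1
  exists_insert {S c x} hc hx := by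
    obtain ⟨c', hc', X, hX, hr⟩ := h.exists_insert (x := x) (hc (cl x)) (by simp [hx])
    refine ⟨fun r => if cl r = cl x then c' r else c r, fun k => ?_, X,
      hX.trans (hd (Nat.succ_le_succ (Finset.card_filter_le _ _))), fun r hrS hrX => ?_⟩
    · by_cases hk : cl x = k
      · subst hk
        rw [Finset.filter_insert, if_pos rfl]
        refine h.congr hc' fun r hr => ?_
        have : cl r = cl x := by
          rcases Finset.mem_insert.1 hr with rfl | hr
          · rfl
          · exact (Finset.mem_filter.1 hr).2
        simp [this]
      · rw [Finset.filter_insert, if_neg hk]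
        refine h.congr (hc k) fun r hr => ?_
        rw [if_neg]
        rw [(Finset.mem_filter.1 hr).2]
        exact Ne.symm hk
    · dsimp only
      split_ifs with hk
      · exact hr r (Finset.mem_filter.2 ⟨hrS, hk⟩) hrX
      · rfl
  exists_erase {S c x} hc hx := by
    obtain ⟨c', hc', X, hX, hr⟩ := h.exists_erase (x := x) (hc (cl x)) (by simp [hx])
    refine ⟨fun r => if cl r = cl x then c' r else c r, fun k => ?_, X,
      hX.trans (hd (Nat.sub_le_sub_right (Finset.card_filter_le _ _) 1)), fun r hrS hrX => ?_⟩
    · by_cases hk : cl x = k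
      · subst hk
        rw [Finset.filter_erase]
        refine h.congr hc' fun r hr => ?_
        simp [(Finset.mem_filter.1 (Finset.mem_of_mem_erase hr)).2]
      · rw [Finset.filter_erase, Finset.erase_eq_of_notMem (by simp [hk])]
        refine h.congr (hc k) fun r hr => ?_
        rw [if_neg]
        rw [(Finset.mem_filter.1 hr).2]
        exact Ne.symm hk
    · dsimp only
      split_ifs with hk
      · refine hr r ?_ hrX
        rw [Finset.mem_erase] at hrS ⊢
        exact ⟨hrS.1, Finset.mem_filter.2 ⟨hrS.2, hk⟩⟩
      · rfl

open Classical in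
/-- The conditions on the coloring `c'` chosen after the update `u`. -/
def IsNextColoring (R : Finset α → (α → γ) → Prop) (d : ℕ → ℕ) (u : Update α) (h : History α)
    (c c' : α → γ) : Prop :=
  R (History.current (u :: h)) c' ∧ ∃ X : List α, X.length ≤ d (History.current (u :: h)).card ∧
    ∀ r ∈ History.current h ∩ History.current (u :: h), r ∉ X → c r = c' r

lemma IsDynamic.exists_next {R : Finset α → (α → γ) → Prop} {d : ℕ → ℕ} (hR : IsDynamic R d)
    {u : Update α} {h : History α} (hv : History.Valid (u :: h)) {c : α → γ}
    (hc : R (History.current h) c) : ∃ c', IsNextColoring R d u h c c' := by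
  classical
  match u, hv with
  | .insert x, hv =>
    obtain ⟨c', hc', X, hX, hr⟩ := hR.exists_insert hc hv.1
    refine ⟨c', hc', X, hX.trans_eq ?_, fun r hrm => hr r (Finset.mem_inter.1 hrm).1⟩
    rw [History.current, Finset.card_insert_of_notMem hv.1]
  | .delete x, hv =>
    obtain ⟨c', hc', X, hX, hr⟩ := hR.exists_erase hc hv.1
    refine ⟨c', hc', X, hX.trans_eq ?_, fun r hrm => hr r (Finset.mem_inter.1 hrm).2⟩
    rw [History.current, Finset.card_erase_of_mem hv.1]

open Classical in
/-- The online strategy that always chooses a suitable next coloring. -/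
noncomputable def onlineColoring [Inhabited γ] (R : Finset α → (α → γ) → Prop) (d : ℕ → ℕ) :
    History α → α → γ
  | [] => fun _ => default
  | u :: h =>
    if hc : ∃ c', IsNextColoring R d u h (onlineColoring R d h) c' then hc.choose
    -- Never reached on valid histories, by `IsDynamic.exists_next`.
    else fun _ => default

lemma History.Valid.tail {u : Update α} {h : History α} (hv : History.Valid (u :: h)) :
    History.Valid h :=
  match u, hv with
  | .insert _, hv => hv.2
  | .delete _, hv => hv.2

lemma IsDynamic.isNextColoring_onlineColoring [Inhabited γ] {R : Finset α → (α → γ) → Prop}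
    {d : ℕ → ℕ} {u : Update α} {h : History α} (hR : IsDynamic R d)
    (hv : History.Valid (u :: h)) (hc : R (History.current h) (onlineColoring R d h)) :
    IsNextColoring R d u h (onlineColoring R d h) (onlineColoring R d (u :: h)) := by
  classical
  have hex := hR.exists_next hv hc
  rw [onlineColoring, dif_pos hex]
  exact hex.choose_spec

lemma IsDynamic.onlineColoring_spec [Inhabited γ] {R : Finset α → (α → γ) → Prop} {d : ℕ → ℕ}
    (hR : IsDynamic R d) : ∀ h : History α, History.Valid h →
      R (History.current h) (onlineColoring R d h)
  | [], _ => hR.empty _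
  | _ :: h, hv =>
    (hR.isNextColoring_onlineColoring hv (hR.onlineColoring_spec h hv.tail)).1

end Dynamic

/-! ### Dyadic classes of intervals -/

lemma exists_dyadic_level (a b : ℕ) : ∃ k, a / 2 ^ k = b / 2 ^ k := by
  refine ⟨a + b, ?_⟩
  have h : a + b < 2 ^ (a + b) := Nat.lt_two_pow_self
  rw [Nat.div_eq_of_lt (by omega), Nat.div_eq_of_lt (by omega)]

/-- The height of the least dyadic interval that contains `a` and `b`. -/
def dyadicLevel (a b : ℕ) : ℕ := Nat.find (exists_dyadic_level a b)

/-- The least dyadic interval that contains `a` and `b`: its height and its index. -/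
def dyadicClass (a b : ℕ) : ℕ × ℕ := (dyadicLevel a b, a / 2 ^ dyadicLevel a b)

lemma dyadicLevel_spec (a b : ℕ) : a / 2 ^ dyadicLevel a b = b / 2 ^ dyadicLevel a b :=
  Nat.find_spec (exists_dyadic_level a b)

lemma dyadicLevel_le {a b N : ℕ} (ha : a < N) (hb : b < N) :
    dyadicLevel a b ≤ Nat.log 2 N + 1 := by
  refine Nat.find_min' _ ?_
  have h : N < 2 ^ (Nat.log 2 N + 1) := Nat.lt_pow_succ_log_self one_lt_two N
  rw [Nat.div_eq_of_lt (ha.trans h), Nat.div_eq_of_lt (hb.trans h)]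

/-- All intervals of a dyadic class have a common point. -/
lemma exists_common_point (k : ℕ × ℕ) :
    ∃ p : ℕ, ∀ a b, a ≤ b → dyadicClass a b = k → a ≤ p ∧ p ≤ b := by
  obtain ⟨k, c⟩ := k
  cases k with
  | zero =>
    refine ⟨c, fun a b _ h => ?_⟩
    obtain ⟨h1, h2⟩ := Prod.mk.inj h
    have h3 := dyadicLevel_spec a b
    rw [h1] at h2 h3
    simp only [pow_zero, Nat.div_one] at h2 h3
    omega
  | succ j =>
    -- The start of the right half of the dyadic interval: by minimality of the level, `a` and `b`
    -- lie in different halves.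
    refine ⟨(2 * c + 1) * 2 ^ j, fun a b hab h => ?_⟩
    obtain ⟨h1, h2⟩ := Prod.mk.inj h
    have h3 := dyadicLevel_spec a b
    have h4 : a / 2 ^ j ≠ b / 2 ^ j :=
      Nat.find_min (exists_dyadic_level a b) (h1 ▸ Nat.lt_succ_self j : j < dyadicLevel a b)
    rw [h1] at h2 h3
    rw [pow_succ, ← Nat.div_div_eq_div_mul] at h2 h3
    rw [← Nat.div_div_eq_div_mul] at h3
    have h5 : a / 2 ^ j ≤ b / 2 ^ j := Nat.div_le_div_right hab
    have h6 : a / 2 ^ j < 2 * c + 1 := by omega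
    have h7 : 2 * c + 1 ≤ b / 2 ^ j := by omega
    exact ⟨((Nat.div_lt_iff_lt_mul (by positivity)).1 h6).le,
      (Nat.le_div_iff_mul_le (by positivity)).1 h7⟩

lemma div_two_pow_le_of_mem {a a' b' k : ℕ} (hk' : a' / 2 ^ k = b' / 2 ^ k) {q : ℝ}
    (h1 : (a : ℝ) ≤ q) (h2 : q ≤ b') : a / 2 ^ k ≤ a' / 2 ^ k := by
  rw [hk']
  exact Nat.div_le_div_right (by exact_mod_cast h1.trans h2)

/-- Intervals of the same dyadic level that have a common point are in the same dyadic class. -/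
lemma dyadicClass_eq {a b a' b' : ℕ} (h : dyadicLevel a b = dyadicLevel a' b') {q : ℝ}
    (hq : q ∈ Set.Icc (a : ℝ) b) (hq' : q ∈ Set.Icc (a' : ℝ) b') :
    dyadicClass a b = dyadicClass a' b' := by
  have h1 := dyadicLevel_spec a b
  have h2 := dyadicLevel_spec a' b'
  rw [← h] at h2
  refine Prod.ext h ?_
  change a / 2 ^ dyadicLevel a b = a' / 2 ^ dyadicLevel a' b'
  rw [← h]
  exact le_antisymm (div_two_pow_le_of_mem h2 hq.1 hq'.2)
    (div_two_pow_le_of_mem h1 hq'.1 hq.2)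

/-! ### Coloring the rectangles -/

namespace GridRect

variable {N : ℕ}

/-- The pair of dyadic classes of the two sides of a rectangle. -/
def dyadicClass (r : GridRect N) : (ℕ × ℕ) × (ℕ × ℕ) :=
  (DynCF.dyadicClass r.x₁ r.x₂, DynCF.dyadicClass r.y₁ r.y₂)

/-- The pair of dyadic levels of the two sides of a rectangle. -/
def dyadicLevel (r : GridRect N) : ℕ × ℕ :=
  (DynCF.dyadicLevel r.x₁ r.x₂, DynCF.dyadicLevel r.y₁ r.y₂)

lemma dyadicClass_eq_of_mem {r r' : GridRect N} (h : r.dyadicLevel = r'.dyadicLevel) {q : ℝ × ℝ}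
    (hq : q ∈ r.region) (hq' : q ∈ r'.region) : r.dyadicClass = r'.dyadicClass :=
  Prod.ext (DynCF.dyadicClass_eq (congrArg Prod.fst h) hq.1 hq'.1)
    (DynCF.dyadicClass_eq (congrArg Prod.snd h) hq.2 hq'.2)

/-- The right side of a rectangle. -/
def right (r : GridRect N) : ℝ := ((r.x₂ : ℕ) : ℝ)

/-- The negated left side of a rectangle. -/
def negLeft (r : GridRect N) : ℝ := -((r.x₁ : ℕ) : ℝ)

/-- The top side of a rectangle. -/
def top (r : GridRect N) : ℝ := ((r.y₂ : ℕ) : ℝ)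

/-- The negated bottom side of a rectangle. -/
def negBottom (r : GridRect N) : ℝ := -((r.y₁ : ℕ) : ℝ)

/-- The pair of a coloring for the points above and a coloring for the points below the common
point of the rectangles in `S`. -/
def PairRepresents (S : Finset (GridRect N))
    (c : GridRect N → (ℕ × ℕ × Bool × Bool) × (ℕ × ℕ × Bool × Bool)) : Prop :=
  Represents top right negLeft S (fun r => (c r).1) ∧
    Represents negBottom right negLeft S fun r => (c r).2

/-- A pair coloring is conflict-free if the rectangles have a common point. -/
lemma PairRepresents.exists_unique {S : Finset (GridRect N)}
    {c : GridRect N → (ℕ × ℕ × Bool × Bool) × (ℕ × ℕ × Bool × Bool)} (h : PairRepresents S c)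
    {px py : ℕ} (hx : ∀ r ∈ S, (r.x₁ : ℕ) ≤ px ∧ px ≤ r.x₂)
    (hy : ∀ r ∈ S, (r.y₁ : ℕ) ≤ py ∧ py ≤ r.y₂) (q : ℝ × ℝ) (hq : ∃ r ∈ S, q ∈ r.region) :
    ∃ r ∈ S, q ∈ r.region ∧ ∀ r' ∈ S, q ∈ r'.region → c r' = c r → r' = r := by
  obtain ⟨qx, qy⟩ := q
  have hx' : ∀ r ∈ S, ((r.x₁ : ℕ) : ℝ) ≤ px ∧ (px : ℝ) ≤ ((r.x₂ : ℕ) : ℝ) := fun r hr =>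
    ⟨by exact_mod_cast (hx r hr).1, by exact_mod_cast (hx r hr).2⟩
  have hy' : ∀ r ∈ S, ((r.y₁ : ℕ) : ℝ) ≤ py ∧ (py : ℝ) ≤ ((r.y₂ : ℕ) : ℝ) := fun r hr =>
    ⟨by exact_mod_cast (hy r hr).1, by exact_mod_cast (hy r hr).2⟩
  -- On either side of `px` one of the two horizontal constraints is automatic.
  obtain ⟨k, a, hk, hka⟩ : ∃ (k : GridRect N → ℝ) (a : ℝ), (k = right ∨ k = negLeft) ∧
      ∀ r ∈ S, (qx ∈ Set.Icc ((r.x₁ : ℕ) : ℝ) ((r.x₂ : ℕ) : ℝ) ↔ a ≤ k r) := by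
    rcases le_total (px : ℝ) qx with hp | hp
    · exact ⟨right, qx, Or.inl rfl, fun r hr =>
        ⟨fun h => h.2, fun h => ⟨(hx' r hr).1.trans hp, h⟩⟩⟩
    · exact ⟨negLeft, -qx, Or.inr rfl, fun r hr =>
        ⟨fun h => neg_le_neg h.1, fun h => ⟨neg_le_neg_iff.1 h, hp.trans (hx' r hr).2⟩⟩⟩
  rcases le_total (py : ℝ) qy with hp | hp
  · have hiff : ∀ r ∈ S, ((qx, qy) ∈ r.region ↔ qy ≤ top r ∧ a ≤ k r) := fun r hr =>
      ⟨fun h => ⟨h.2.2, (hka r hr).1 h.1⟩,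
        fun h => ⟨(hka r hr).2 h.2, (hy' r hr).1.trans hp, h.1⟩⟩
    obtain ⟨r₀, hr₀, hq₀⟩ := hq
    obtain ⟨r, hr, hrq, hu⟩ := h.1.exists_unique hk a qy ⟨r₀, hr₀, (hiff r₀ hr₀).1 hq₀⟩
    exact ⟨r, hr, (hiff r hr).2 hrq, fun r' hr' hq' he =>
      hu r' hr' ((hiff r' hr').1 hq') (congrArg Prod.fst he)⟩
  · have hiff : ∀ r ∈ S, ((qx, qy) ∈ r.region ↔ -qy ≤ negBottom r ∧ a ≤ k r) := fun r hr =>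
      ⟨fun h => ⟨neg_le_neg h.2.1, (hka r hr).1 h.1⟩,
        fun h => ⟨(hka r hr).2 h.2, neg_le_neg_iff.1 h.1, hp.trans (hy' r hr).2⟩⟩
    obtain ⟨r₀, hr₀, hq₀⟩ := hq
    obtain ⟨r, hr, hrq, hu⟩ := h.2.exists_unique hk a (-qy) ⟨r₀, hr₀, (hiff r₀ hr₀).1 hq₀⟩
    exact ⟨r, hr, (hiff r hr).2 hrq, fun r' hr' hq' he =>
      hu r' hr' ((hiff r' hr').1 hq') (congrArg Prod.snd he)⟩

/-- The coloring of every dyadic class is a pair coloring. -/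
def ClassRepresents (S : Finset (GridRect N))
    (c : GridRect N → (ℕ × ℕ × Bool × Bool) × (ℕ × ℕ × Bool × Bool)) : Prop :=
  ∀ k, PairRepresents (S.filter fun r => r.dyadicClass = k) c

lemma isDynamic_classRepresents : IsDynamic (ClassRepresents (N := N))
    fun m => (30 * Nat.log 2 (m + 1) + 20) + (30 * Nat.log 2 (m + 1) + 20) := by
  classical
  have h := ((isDynamic_represents (top (N := N)) right negLeft).prod
    (isDynamic_represents negBottom right negLeft)).classes ?_ dyadicClass
  · convert h using 1
    funext S c
    refine propext (forall_congr' fun k => ?_)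
    rw [PairRepresents]
    congr!
  · intro m m' hm
    have : Nat.log 2 (m + 1) ≤ Nat.log 2 (m' + 1) := Nat.log_mono_right (Nat.succ_le_succ hm)
    dsimp only
    omega

/-- The color of a rectangle: its dyadic levels and its color within its dyadic class. -/
def fullColor (c : GridRect N → (ℕ × ℕ × Bool × Bool) × (ℕ × ℕ × Bool × Bool))
    (r : GridRect N) : ℕ := Encodable.encode (r.dyadicLevel, c r)

variable {S : Finset (GridRect N)}
  {c : GridRect N → (ℕ × ℕ × Bool × Bool) × (ℕ × ℕ × Bool × Bool)}

/-- Only the class of one rectangle containing `q` is needed: a rectangle containing `q` with the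
color of the chosen one has its levels, hence its class, and there the pair coloring decides. -/
lemma ClassRepresents.isConflictFree (h : ClassRepresents S c) :
    IsConflictFree region S (fullColor c) := by
  rintro q ⟨r₀, hr₀, hq₀⟩
  obtain ⟨px, hpx⟩ := exists_common_point r₀.dyadicClass.1
  obtain ⟨py, hpy⟩ := exists_common_point r₀.dyadicClass.2
  obtain ⟨r, hr, hq, hu⟩ := (h r₀.dyadicClass).exists_unique (px := px) (py := py)
    (fun r hr => hpx _ _ r.hx (congrArg Prod.fst (Finset.mem_filter.1 hr).2))
    (fun r hr => hpy _ _ r.hy (congrArg Prod.snd (Finset.mem_filter.1 hr).2)) q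
    ⟨r₀, Finset.mem_filter.2 ⟨hr₀, rfl⟩, hq₀⟩
  refine ⟨r, (Finset.mem_filter.1 hr).1, hq, fun r' hr' hq' he => ?_⟩
  obtain ⟨h1, h2⟩ := Prod.mk.inj (Encodable.encode_injective he)
  exact hu r' (Finset.mem_filter.2 ⟨hr', (dyadicClass_eq_of_mem h1 hq' hq).trans
    (Finset.mem_filter.1 hr).2⟩) hq' h2

/-- The colors of a half-plane coloring with at most `n` objects. -/
def halfPalette (n : ℕ) : Finset (ℕ × ℕ × Bool × Bool) :=
  Finset.range (Nat.log 2 n + 1) ×ˢ Finset.range 3 ×ˢ Finset.univ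

lemma card_halfPalette (n : ℕ) : (halfPalette n).card = 12 * (Nat.log 2 n + 1) := by
  simp [halfPalette]
  ring

/-- The color records the levels but not the positions of the dyadic intervals, so the factor
depending on `N` is polylogarithmic. -/
lemma ClassRepresents.card_image_le (h : ClassRepresents S c) :
    (S.image (fullColor c)).card ≤
      (Nat.log 2 N + 2) ^ 2 * (12 * (Nat.log 2 S.card + 1)) ^ 2 := by
  have hsub : S.image (fullColor c) ⊆
      (((Finset.range (Nat.log 2 N + 2)) ×ˢ (Finset.range (Nat.log 2 N + 2))) ×ˢ
        (halfPalette S.card ×ˢ halfPalette S.card)).image Encodable.encode := by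
    intro k hk
    obtain ⟨r, hr, rfl⟩ := Finset.mem_image.1 hk
    refine Finset.mem_image_of_mem _ ?_
    have hmem : r ∈ S.filter fun s => s.dyadicClass = r.dyadicClass :=
      Finset.mem_filter.2 ⟨hr, rfl⟩
    have hlog : Nat.log 2 (S.filter fun s => s.dyadicClass = r.dyadicClass).card ≤
      Nat.log 2 S.card := Nat.log_mono_right (Finset.card_filter_le _ _)
    obtain ⟨h1, h2⟩ := (h r.dyadicClass).1.color_bound hmem
    obtain ⟨h3, h4⟩ := (h r.dyadicClass).2.color_bound hmem
    have h5 := dyadicLevel_le r.x₁.isLt r.x₂.isLt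
    have h6 := dyadicLevel_le r.y₁.isLt r.y₂.isLt
    simp only [halfPalette, Finset.mem_product, Finset.mem_range, Finset.mem_univ, and_true,
      dyadicLevel]
    omega
  refine (Finset.card_le_card hsub).trans (Finset.card_image_le.trans ?_)
  simp only [Finset.card_product, Finset.card_range, card_halfPalette]
  exact le_of_eq (by ring)

end GridRect

/-! ### Logarithm estimates and the theorem -/

lemma natLog_succ_le_log (m : ℕ) : (Nat.log 2 (m + 1) : ℝ) ≤ 2 * Real.log ((m : ℝ) + 1) := by
  have h : ((2 ^ Nat.log 2 (m + 1) : ℕ) : ℝ) ≤ (m : ℝ) + 1 := by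
    exact_mod_cast Nat.pow_log_le_self 2 m.succ_ne_zero
  have h2 := Real.log_le_log (by positivity) h
  rw [Nat.cast_pow, Real.log_pow] at h2
  have h3 := Real.log_two_gt_d9
  have h4 : (0 : ℝ) ≤ Nat.log 2 (m + 1) := Nat.cast_nonneg _
  norm_num at h2
  nlinarith

lemma one_le_natLog_succ {m : ℕ} (hm : 1 ≤ m) : 1 ≤ Nat.log 2 (m + 1) :=
  Nat.le_log_of_pow_le one_lt_two (by omega)

end DynCF

theorem mainTheorem6 :
    ∃ C : ℝ, 0 < C ∧ ∀ N : ℕ, ∃ A : DynCF.Strategy (DynCF.GridRect N),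
      (∀ h : DynCF.History (DynCF.GridRect N), DynCF.History.Valid h →
        DynCF.IsConflictFree DynCF.GridRect.region (DynCF.History.current h) (A h) ∧
        (DynCF.Strategy.numColors A h : ℝ) ≤
          C * Real.log ((N : ℝ) + 1) ^ 2 *
            Real.log (((DynCF.History.current h).card : ℝ) + 1) ^ 2) ∧
      (∀ (u : DynCF.Update (DynCF.GridRect N)) (h : DynCF.History (DynCF.GridRect N)),
        DynCF.History.Valid (u :: h) →
        (DynCF.Strategy.numRecolorings A u h : ℝ) ≤
          C * Real.log (((DynCF.History.current (u :: h)).card : ℝ) + 1)) := by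
  classical
  -- The color count needs (3 · 2)² · (24 · 2)² = 82944; the recolorings need only 100 · 2.
  refine ⟨82944, by norm_num, fun N => ?_⟩
  have hR := DynCF.GridRect.isDynamic_classRepresents (N := N)
  set d : ℕ → ℕ := fun m => (30 * Nat.log 2 (m + 1) + 20) + (30 * Nat.log 2 (m + 1) + 20) with hd
  refine ⟨fun h => DynCF.GridRect.fullColor
    (DynCF.onlineColoring DynCF.GridRect.ClassRepresents d h), fun h hv => ?_, fun u h hv => ?_⟩
  · have hs := hR.onlineColoring_spec h hv
    refine ⟨hs.isConflictFree, ?_⟩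
    have hcard := hs.card_image_le
    rw [DynCF.Strategy.numColors]
    set S := DynCF.History.current h
    rcases S.eq_empty_or_nonempty with hS | ⟨r, hr⟩
    · rw [hS]
      simp
    have hS1 := DynCF.one_le_natLog_succ (Finset.card_pos.2 ⟨r, hr⟩)
    have hN1 := DynCF.one_le_natLog_succ (show 1 ≤ N from r.x₁.pos)
    have hS2 : Nat.log 2 S.card ≤ Nat.log 2 (S.card + 1) := Nat.log_mono_right (Nat.le_succ _)
    have hN2 : Nat.log 2 N ≤ Nat.log 2 (N + 1) := Nat.log_mono_right (Nat.le_succ _)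
    have hle : (Nat.log 2 N + 2) ^ 2 * (12 * (Nat.log 2 S.card + 1)) ^ 2 ≤
        (3 * Nat.log 2 (N + 1)) ^ 2 * (24 * Nat.log 2 (S.card + 1)) ^ 2 :=
      Nat.mul_le_mul (Nat.pow_le_pow_left (by omega) 2) (Nat.pow_le_pow_left (by omega) 2)
    calc _ ≤ (((3 * Nat.log 2 (N + 1)) ^ 2 * (24 * Nat.log 2 (S.card + 1)) ^ 2 : ℕ) : ℝ) :=
          Nat.cast_le.2 (hcard.trans hle)
      _ = (3 * (Nat.log 2 (N + 1) : ℝ)) ^ 2 * (24 * (Nat.log 2 (S.card + 1) : ℝ)) ^ 2 := by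
          push_cast
          rfl
      _ ≤ (3 * (2 * Real.log ((N : ℝ) + 1))) ^ 2 *
          (24 * (2 * Real.log ((S.card : ℝ) + 1))) ^ 2 := by
          gcongr
          · exact DynCF.natLog_succ_le_log N
          · exact DynCF.natLog_succ_le_log S.card
      _ = _ := by ring
  · obtain ⟨-, X, hX, hrec⟩ :=
      hR.isNextColoring_onlineColoring hv (hR.onlineColoring_spec h hv.tail)
    rw [DynCF.Strategy.numRecolorings]
    set S := DynCF.History.current (u :: h)
    -- If nothing remains, the bound is zero, and there is nothing to recolor.
    rcases S.eq_empty_or_nonempty with hS | hS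
    · rw [hS]
      simp
    have hS1 := DynCF.one_le_natLog_succ (Finset.card_pos.2 hS)
    have hlog := DynCF.natLog_succ_le_log S.card
    refine (Nat.cast_le.2 ((Finset.card_le_card (t := X.toFinset) ?_).trans
      (X.toFinset_card_le.trans
        (hX.trans (show d S.card ≤ 100 * Nat.log 2 (S.card + 1) by simp only [hd]; omega))))).trans
      ?_
    · intro r hr
      obtain ⟨hr1, hr2⟩ := Finset.mem_filter.1 hr
      rw [List.mem_toFinset]
      by_contra hrX
      refine hr2 ?_
      rw [DynCF.GridRect.fullColor, DynCF.GridRect.fullColor, hrec r hr1 hrX]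
    · have : (0 : ℝ) ≤ Nat.log 2 (S.card + 1) := Nat.cast_nonneg _
      push_cast
      linarith
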